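/- Let $\Gamma\subseteq\mathrm{PSL}_2(\mathbb{R})$ be a Fuchsian subgroup, i.e. a discrete subgroup, acting by fractional linear transformations on the upper half-plane $\mathbb{H}$, and assume that $\Gamma$ is cocompact, i.e. that the quotient $M=\Gamma\backslash\mathbb{H}$ is compact. For an integer $k\ge 1$ let $\mathcal{S}_{2k}^{\Gamma}$ be the complex vector space of cusp forms of weight $2k$ for $\Gamma$, i.e. of holomorphic functions $f:\mathbb{H}\to\mathbb{C}$ with $f(\gamma z)=(cz+d)^{2k}f(z)$ for all $\gamma=\begin{pmatrix}a&b\\c&d\end{pmatrix}\in\Gamma$ that vanish at all cusps of $\Gamma$, equipped with the Petersson inner product $$\langle f_1,f_2\rangle=\int_{M}f_1(z)\overline{f_2(z)}\,y^{2k}\,\frac{dx\,dy}{y^2},\qquad z=x+iy,$$ the integral over $M$ being taken over a (measurable) fundamental domain of $\Gamma$; such a domain exists. Then there is a constant $C_\Gamma$, depending only on $\Gamma$, such that for every $k\ge 1$: the space $\mathcal{S}_{2k}^{\Gamma}$ has a finite orthonormal basis, and for every orthonormal basis $f_1,\dots,f_d$ of $\mathcal{S}_{2k}^{\Gamma}$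 the function $$S_k^{\Gamma}(z)=\sum_{j=1}^{d}|f_j(z)|^2\,\mathrm{Im}(z)^{2k}$$ is bounded on $\mathbb{H}$ (equivalently on $M$), with $$\sup_{z\in M}S_k^{\Gamma}(z)\le C_\Gamma\,k.$$ -/

import Mathlib

open MeasureTheory
open scoped MatrixGroups UpperHalfPlane

noncomputable section

namespace Fuchsian

/-- The action of `PSL(2, ℝ)` on the upper half-plane by fractional linear transformations, as a
homomorphism to the permutations of `ℍ`: the action of `SL(2, ℝ)` factors through the quotient by
the centre. -/
def pslToPerm : PSL(2, ℝ) →* Equiv.Perm ℍ :=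
  QuotientGroup.lift (Subgroup.center SL(2, ℝ)) (MulAction.toPermHom SL(2, ℝ) ℍ) (by
    intro g hg
    obtain ⟨r, hr, hg'⟩ := Matrix.SpecialLinearGroup.mem_center_iff.mp hg
    have h00 : g 0 0 = r := by
      have := congrFun (congrFun hg' 0) 0
      simpa using this.symm
    have h01 : g 0 1 = 0 := by
      have := congrFun (congrFun hg' 0) 1
      simpa using this.symm
    have h10 : g 1 0 = 0 := by
      have := congrFun (congrFun hg' 1) 0
      simpa using this.symm
    have h11 : g 1 1 = r := by
      have := congrFun (congrFun hg' 1) 1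
      simpa using this.symm
    have hr0 : (r : ℂ) ≠ 0 := by
      rintro h
      have : r = 0 := by exact_mod_cast h
      simp [this] at hr
    ext z
    simp [UpperHalfPlane.coe_specialLinearGroup_apply, h00, h01, h10, h11, hr0])

instance pslMulAction : MulAction PSL(2, ℝ) ℍ :=
  MulAction.compHom ℍ pslToPerm

theorem psl_mk_smul (g : SL(2, ℝ)) (z : ℍ) : (g : PSL(2, ℝ)) • z = g • z := rfl

/-- A Fuchsian subgroup of `PSL(2, ℝ)`: a subgroup that is discrete for the quotient topology
of `PSL(2, ℝ) = SL(2, ℝ) / {±1}`. -/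
def IsFuchsian (Γ : Subgroup PSL(2, ℝ)) : Prop := DiscreteTopology Γ

/-- `Γ` is cocompact: the quotient space `M = Γ \ ℍ` is compact. -/
def IsCocompact (Γ : Subgroup PSL(2, ℝ)) : Prop :=
  CompactSpace (MulAction.orbitRel.Quotient Γ ℍ)

/-- The group of all real matrices of determinant one that represent elements of `Γ`. -/
def matrixLift (Γ : Subgroup PSL(2, ℝ)) : Subgroup (GL (Fin 2) ℝ) :=
  (Γ.comap (QuotientGroup.mk' (Subgroup.center SL(2, ℝ)))).map Matrix.SpecialLinearGroup.toGL

instance matrixLift_hasDetOne (Γ : Subgroup PSL(2, ℝ)) : (matrixLift Γ).HasDetOne :=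
  inferInstanceAs (Subgroup.HasDetOne (Subgroup.map Matrix.SpecialLinearGroup.toGL _))

/-- The complex vector space of cusp forms of weight `2k` for `Γ`: holomorphic functions `f` on
`ℍ` with `f (γ z) = (c z + d) ^ (2k) f z` for all matrices representing elements of `Γ`, vanishing
at all cusps of `Γ`. -/
abbrev CuspForms (Γ : Subgroup PSL(2, ℝ)) (k : ℕ) : Type := CuspForm (matrixLift Γ) (2 * (k : ℤ))

/-- The Petersson inner product `∫_M f₁ conj(f₂) y ^ (2k) dμ_hyp`, the integral over
`M = Γ \ ℍ` being computed over a fundamental domain `D` of `Γ`. The measure `volume` on `ℍ` is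
`dx dy / y ^ 2`. -/
def peterssonInner {Γ : Subgroup PSL(2, ℝ)} {k : ℕ} (D : Set ℍ) (f₁ f₂ : CuspForms Γ k) : ℂ :=
  ∫ z in D, f₁ z * (starRingEnd ℂ) (f₂ z) * ((z.im : ℝ) : ℂ) ^ (2 * k)

/-- `f₁, …, f_d` is an orthonormal basis of the space of cusp forms of weight `2k` with respect to
the Petersson inner product. -/
structure IsPeterssonONB {Γ : Subgroup PSL(2, ℝ)} {k : ℕ} (D : Set ℍ) {d : ℕ}
    (f : Fin d → CuspForms Γ k) : Prop where
  orthonormal : ∀ i j, peterssonInner D (f i) (f j) = if i = j then 1 else 0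
  span_eq_top : Submodule.span ℂ (Set.range f) = ⊤

/-- `S_k^Γ(z) = ∑ⱼ |fⱼ(z)|² Im(z) ^ (2k)`, for a finite family `f₁, …, f_d`. -/
def supSum {Γ : Subgroup PSL(2, ℝ)} {k d : ℕ} (f : Fin d → CuspForms Γ k) (z : ℍ) : ℝ :=
  ∑ j, ‖f j z‖ ^ 2 * z.im ^ (2 * k)

end Fuchsian

end

namespace Fuchsian

/-! By Bessel's inequality, `∑ |f_j(z)|²` is at most the squared norm of evaluation at `z` for the
Petersson norm. So it suffices to bound a single form: `|f(z)|² y^(2k) ≤ C k ‖f‖²` with `C`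
depending only on `Γ` (`exists_normSqIm_le`).

That bound is local (`ofReal_normSqIm_le`). On the Euclidean disc of radius `y₀ / (2√k)` about `z₀`,
the weight `y^k` is, up to a bounded factor, bounded below by the modulus of a nonvanishing
holomorphic function with the same value at `z₀`. Multiplying `f` by that function reduces the claim
to the mean value property, and the disc has hyperbolic area of order `1/k`, whence the factor `k`.
The disc lies in a unit hyperbolic ball, which covers the quotient at most `N` times, with `N`
uniform by proper discontinuity and cocompactness (`exists_card_smul_mem_ball_le`,
`lintegral_ball_le`).

Integrating the resulting bound on `supSum` over a fundamental domain bounds the size of every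
orthonormal family, so the space is finite-dimensional. -/

/-! ### Proper discontinuity and uniform orbit counts -/

theorem isClosed_center_SL : IsClosed (Subgroup.center SL(2, ℝ) : Set SL(2, ℝ)) := by
  have : (Subgroup.center SL(2, ℝ) : Set SL(2, ℝ)) = Set.centralizer Set.univ := by
    rw [Set.centralizer_univ]; rfl
  rw [this]
  exact Set.isClosed_centralizer _

/-- A discrete subgroup of `PSL(2, ℝ)` acts properly discontinuously on `ℍ`. -/
theorem finite_smul_inter {Γ : Subgroup PSL(2, ℝ)} (hΓ : IsFuchsian Γ) {K : Set ℍ}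
    (hK : IsCompact K) : {γ : Γ | ∃ z ∈ K, γ • z ∈ K}.Finite := by
  have : IsClosed (Subgroup.center SL(2, ℝ) : Set SL(2, ℝ)) := isClosed_center_SL
  have hT3 : T3Space PSL(2, ℝ) :=
    inferInstanceAs (T3Space (SL(2, ℝ) ⧸ Subgroup.center SL(2, ℝ)))
  have : IsTopologicalGroup PSL(2, ℝ) :=
    inferInstanceAs (IsTopologicalGroup (SL(2, ℝ) ⧸ Subgroup.center SL(2, ℝ)))
  have hdisc : DiscreteTopology Γ := hΓ
  have hclosed : IsClosed (Γ : Set PSL(2, ℝ)) := Subgroup.isClosed_of_discrete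
  -- Properness of the `SL(2, ℝ)` action makes the set of matrices moving `K` to meet itself
  -- compact. Its image in `PSL(2, ℝ)` meets the closed discrete `Γ` in a finite set.
  have hpre : IsCompact ((fun p : SL(2, ℝ) × ℍ ↦ (p.1 • p.2, p.2)) ⁻¹' (K ×ˢ K)) :=
    (ProperSMul.isProperMap_smul_pair (G := SL(2, ℝ)) (X := ℍ)).isCompact_preimage (hK.prod hK)
  have himg := (hpre.image continuous_fst).image
    (QuotientGroup.continuous_mk (N := Subgroup.center SL(2, ℝ)))
  have hfin := (hclosed.isClosedEmbedding_subtypeVal.isCompact_preimage himg).finite_of_discrete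
  refine hfin.subset ?_
  rintro ⟨γ, hγ⟩ ⟨z, hz, hγz⟩
  obtain ⟨g, rfl⟩ := QuotientGroup.mk_surjective γ
  exact ⟨g, ⟨(g, z), ⟨hγz, hz⟩, rfl⟩, rfl⟩

theorem countable_of_isFuchsian {Γ : Subgroup PSL(2, ℝ)} (hΓ : IsFuchsian Γ) : Countable Γ := by
  rw [← Set.countable_univ_iff]
  have : (Set.univ : Set Γ) ⊆ ⋃ n : ℕ, {γ : Γ | ∃ z ∈ Metric.closedBall UpperHalfPlane.I (n : ℝ),
      γ • z ∈ Metric.closedBall UpperHalfPlane.I (n : ℝ)} := by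
    intro γ _
    obtain ⟨n, hn⟩ := exists_nat_ge (dist (γ • UpperHalfPlane.I) UpperHalfPlane.I)
    exact Set.mem_iUnion.mpr ⟨n, UpperHalfPlane.I, by simp, hn⟩
  exact (Set.countable_iUnion fun n ↦
    (finite_smul_inter hΓ (isCompact_closedBall _ _)).countable).mono this

instance : IsIsometricSMul PSL(2, ℝ) ℍ where
  isometry_smul γ := by
    obtain ⟨g, rfl⟩ := QuotientGroup.mk_surjective γ
    exact isometry_smul ℍ g

instance : MeasurableConstSMul PSL(2, ℝ) ℍ where
  measurable_const_smul γ := (isometry_smul ℍ γ).continuous.measurable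

instance : SMulInvariantMeasure PSL(2, ℝ) ℍ volume where
  measure_preimage_smul γ s hs := by
    obtain ⟨g, rfl⟩ := QuotientGroup.mk_surjective γ
    exact measure_preimage_smul_of_nullMeasurableSet (G := GL (Fin 2) ℝ) (μ := volume)
      hs.nullMeasurableSet (Matrix.SpecialLinearGroup.mapGL ℝ g)

/-- A compact quotient `Γ \ ℍ` is covered by a compact subset of `ℍ`. -/
theorem exists_isCompact_cover {Γ : Subgroup PSL(2, ℝ)} (hc : IsCocompact Γ) :
    ∃ R : ℝ, ∀ z : ℍ, ∃ γ : Γ, γ • z ∈ Metric.closedBall UpperHalfPlane.I R := by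
  have : CompactSpace (MulAction.orbitRel.Quotient Γ ℍ) := hc
  have : ContinuousConstSMul Γ ℍ := ⟨fun γ ↦ (isometry_smul ℍ (γ : PSL(2, ℝ))).continuous⟩
  let q : ℍ → MulAction.orbitRel.Quotient Γ ℍ := Quotient.mk _
  have hq : IsOpenMap q := isOpenMap_quotient_mk'_mul
  obtain ⟨n, hn⟩ := isCompact_univ.elim_directed_cover
    (fun n : ℕ ↦ q '' Metric.ball UpperHalfPlane.I n)
    (fun n ↦ hq _ Metric.isOpen_ball) (by
      intro x _
      obtain ⟨z, rfl⟩ := Quotient.mk_surjective x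
      obtain ⟨n, hn⟩ := exists_nat_gt (dist z UpperHalfPlane.I)
      exact Set.mem_iUnion.mpr ⟨n, z, hn, rfl⟩)
    (Monotone.directed_le fun m n h ↦ Set.image_mono (Metric.ball_subset_ball (by exact_mod_cast h)))
  refine ⟨n, fun z ↦ ?_⟩
  obtain ⟨w, hw, hwz⟩ := hn (Set.mem_univ (q z))
  obtain ⟨γ, hγ⟩ := MulAction.orbitRel_apply.mp (Quotient.exact hwz)
  exact ⟨γ, by
    have hγ' : γ • z = w := hγ
    rw [hγ']; exact Metric.ball_subset_closedBall hw⟩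

/-- The number of `γ` moving a point into a given ball is bounded uniformly. -/
theorem exists_card_smul_mem_ball_le {Γ : Subgroup PSL(2, ℝ)} (hΓ : IsFuchsian Γ)
    (hc : IsCocompact Γ) (r : ℝ) :
    ∃ N : ℕ, ∀ z w : ℍ, {γ : Γ | dist (γ • z) w ≤ r}.encard ≤ N := by
  obtain ⟨R, hR⟩ := exists_isCompact_cover hc
  have hfin := finite_smul_inter hΓ
    (isCompact_closedBall UpperHalfPlane.I (R + 2 * r))
  refine ⟨hfin.toFinset.card, fun z w ↦ ?_⟩
  obtain ⟨δ, hδ⟩ := hR w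
  rcases Set.eq_empty_or_nonempty {γ : Γ | dist (γ • z) w ≤ r} with he | ⟨γ₁, h₁⟩
  · simp [he]
  rw [← hfin.encard_eq_coe_toFinset_card]
  -- `γ * γ₁⁻¹` moves `γ₁ • z` to `γ • z`, both within `r` of `w`; conjugating by `δ` brings
  -- everything near `I`, where one finite set serves all `z` and `w`.
  refine Set.encard_le_encard_of_injOn (f := fun γ ↦ δ * γ * γ₁⁻¹ * δ⁻¹) ?_ ?_
  · intro γ hγ
    have hr : 0 ≤ r := dist_nonneg.trans h₁
    have e1 : dist (δ • γ₁ • z) (δ • w) ≤ r := by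
      have := dist_smul (δ : PSL(2, ℝ)) ((γ₁ : PSL(2, ℝ)) • z) w
      exact this.trans_le h₁
    have e2 : dist (δ • γ • z) (δ • w) ≤ r := by
      have := dist_smul (δ : PSL(2, ℝ)) ((γ : PSL(2, ℝ)) • z) w
      exact this.trans_le hγ
    have hδ' : dist (δ • w) UpperHalfPlane.I ≤ R := hδ
    refine ⟨δ • γ₁ • z, ?_, ?_⟩
    · have := dist_triangle (δ • γ₁ • z) (δ • w) UpperHalfPlane.I
      simp only [Metric.mem_closedBall]; linarith
    · have := dist_triangle (δ • γ • z) (δ • w) UpperHalfPlane.I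
      simp only [Metric.mem_closedBall, mul_smul, inv_smul_smul]; linarith
  · intro a _ b _ h
    simpa using h

/-! ### The local estimate -/

/-- The sub-mean value property of `‖g‖²` on discs, for holomorphic `g`. -/
theorem enorm_sq_mul_le_lintegral_ball {g : ℂ → ℂ} {c : ℂ} {r : ℝ} (hr : 0 ≤ r)
    (hg : DifferentiableOn ℂ g (Metric.ball c r)) :
    ‖g c‖ₑ ^ 2 * ENNReal.ofReal (Real.pi * r ^ 2) ≤ ∫⁻ z in Metric.ball c r, ‖g z‖ₑ ^ 2 := by
  have hcirc : ∀ ρ ∈ Set.Ioo 0 r, ‖g c‖ₑ ^ 2 * ENNReal.ofReal (2 * Real.pi) ≤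
      ∫⁻ θ in Set.Ioo (-Real.pi) Real.pi, ‖g (circleMap c ρ θ)‖ₑ ^ 2 := by
    intro ρ hρ
    -- The mean value property is applied to the holomorphic `g ^ 2`; taking norms then gives the
    -- inequality for `‖g‖²`.
    have hd : DiffContOnCl ℂ (fun z ↦ g z ^ 2) (Metric.ball c |ρ|) := by
      refine DifferentiableOn.diffContOnCl ?_
      refine (hg.pow 2).mono (Metric.closure_ball_subset_closedBall.trans ?_)
      rw [abs_of_pos hρ.1]
      exact Metric.closedBall_subset_ball hρ.2
    have h1 := hd.circleAverage
    rw [Real.circleAverage_eq_integral_add (-Real.pi),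
      intervalIntegral.integral_comp_add_right (fun θ ↦ g (circleMap c ρ θ) ^ 2)] at h1
    have h2 : (2 * Real.pi) • g c ^ 2 =
        ∫ θ in Set.Ioc (-Real.pi) Real.pi, g (circleMap c ρ θ) ^ 2 := by
      rw [← h1, smul_smul, mul_inv_cancel₀ (by positivity), one_smul,
        ← intervalIntegral.integral_of_le (by linarith [Real.pi_pos])]
      congr 1 <;> ring
    calc ‖g c‖ₑ ^ 2 * ENNReal.ofReal (2 * Real.pi) = ‖(2 * Real.pi) • g c ^ 2‖ₑ := by
          rw [enorm_smul, enorm_pow, mul_comm, Real.enorm_of_nonneg (by positivity)]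
      _ ≤ ∫⁻ θ in Set.Ioc (-Real.pi) Real.pi, ‖g (circleMap c ρ θ) ^ 2‖ₑ := by
          rw [h2]; exact enorm_integral_le_lintegral_enorm _
      _ = _ := by
          rw [restrict_Ioo_eq_restrict_Ioc]; simp_rw [enorm_pow]
  -- Extension by zero allows polar coordinates and translation on all of `ℂ`.
  let F : ℂ → ENNReal := (Metric.ball c r).indicator fun z ↦ ‖g z‖ₑ ^ 2
  have hF : Measurable F := by
    have : ContinuousOn (fun z ↦ ‖g z‖ₑ ^ 2) (Metric.ball c r) :=
      ((ENNReal.continuous_pow 2).comp continuous_enorm).comp_continuousOn hg.continuousOn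
    classical
    rw [show F = (Metric.ball c r).piecewise (fun z ↦ ‖g z‖ₑ ^ 2) 0 from
      (Set.piecewise_eq_indicator ..).symm]
    exact this.measurable_piecewise continuousOn_const Metric.isOpen_ball.measurableSet
  have hlin : ENNReal.ofReal (r ^ 2 / 2) = ∫⁻ ρ in Set.Ioo 0 r, ENNReal.ofReal ρ := by
    rw [restrict_Ioo_eq_restrict_Ioc, ← ofReal_integral_eq_lintegral_ofReal,
      ← intervalIntegral.integral_of_le hr, integral_id]
    · simp
    · exact (intervalIntegrable_iff_integrableOn_Ioc_of_le hr).mp intervalIntegral.intervalIntegrable_id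
    · filter_upwards [ae_restrict_mem measurableSet_Ioc] with x hx using hx.1.le
  calc ‖g c‖ₑ ^ 2 * ENNReal.ofReal (Real.pi * r ^ 2)
      = (∫⁻ ρ in Set.Ioo 0 r, ENNReal.ofReal ρ) *
          (‖g c‖ₑ ^ 2 * ENNReal.ofReal (2 * Real.pi)) := by
        rw [← hlin, mul_comm, mul_comm (‖g c‖ₑ ^ 2), ← mul_assoc,
          ← ENNReal.ofReal_mul (by positivity)]
        ring_nf
    _ = ∫⁻ ρ in Set.Ioo 0 r, ENNReal.ofReal ρ *
          (‖g c‖ₑ ^ 2 * ENNReal.ofReal (2 * Real.pi)) := by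
        rw [lintegral_mul_const _ (by fun_prop)]
    _ ≤ ∫⁻ ρ in Set.Ioo 0 r, ENNReal.ofReal ρ *
          ∫⁻ θ in Set.Ioo (-Real.pi) Real.pi, F (circleMap c ρ θ) := by
        refine setLIntegral_mono' measurableSet_Ioo fun ρ hρ ↦ ?_
        gcongr
        refine (hcirc ρ hρ).trans_eq (lintegral_congr fun θ ↦ ?_)
        refine (Set.indicator_of_mem (s := Metric.ball c r) ?_ fun z ↦ ‖g z‖ₑ ^ 2).symm
        simpa [circleMap, abs_of_pos hρ.1] using hρ.2
    _ ≤ ∫⁻ ρ in Set.Ioi 0, ENNReal.ofReal ρ *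
          ∫⁻ θ in Set.Ioo (-Real.pi) Real.pi, F (circleMap c ρ θ) :=
        lintegral_mono_set Set.Ioo_subset_Ioi_self
    _ = ∫⁻ p in polarCoord.target, ENNReal.ofReal p.1 • F (c + Complex.polarCoord.symm p) := by
        have hm : Measurable fun p : ℝ × ℝ ↦
            ENNReal.ofReal p.1 • F (c + Complex.polarCoord.symm p) := by
          simp only [Complex.polarCoord_symm_apply, smul_eq_mul]
          refine (by fun_prop : Measurable fun p : ℝ × ℝ ↦ ENNReal.ofReal p.1).mul
            (hF.comp (by fun_prop))
        rw [polarCoord_target, Measure.volume_eq_prod, ← Measure.prod_restrict,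
          lintegral_prod _ hm.aemeasurable]
        refine lintegral_congr fun ρ ↦ ?_
        simp_rw [smul_eq_mul]
        rw [lintegral_const_mul' _ _ ENNReal.ofReal_ne_top]
        congr 1
        refine lintegral_congr fun θ ↦ ?_
        simp [circleMap, Complex.exp_mul_I]
    _ = ∫⁻ z, F (c + z) := Complex.lintegral_comp_polarCoord_symm fun z ↦ F (c + z)
    _ = ∫⁻ z, F z := lintegral_add_left_eq_self F c
    _ = _ := lintegral_indicator Metric.isOpen_ball.measurableSet _

open scoped Manifold

/-- The invariant square norm `|f(z)|² Im(z) ^ (2k)` of a weight `2k` form. -/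
noncomputable def normSqIm (k : ℕ) (f : ℍ → ℂ) (z : ℍ) : ℝ := ‖f z‖ ^ 2 * z.im ^ (2 * k)

theorem normSqIm_nonneg (k : ℕ) (f : ℍ → ℂ) (z : ℍ) : 0 ≤ normSqIm k f z := by
  have := z.im_pos
  unfold normSqIm
  positivity

theorem continuous_normSqIm (k : ℕ) {f : ℍ → ℂ} (hf : Continuous f) :
    Continuous (normSqIm k f) := by
  unfold normSqIm
  fun_prop

theorem lintegral_coe_upperHalfPlane {H : ℂ → ENNReal} (hH : Measurable fun z : ℍ ↦ H z) :
    ∫⁻ z : ℍ, H z = ∫⁻ z in {z : ℂ | 0 < z.im}, ENNReal.ofReal (1 / z.im ^ 2) * H z := by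
  have hmeas : Measurable fun z : ℍ ↦ ((1 / NNReal.mk z.im z.im_pos.le : NNReal) ^ 2) := by
    refine Continuous.measurable ?_
    refine .pow (.div₀ continuous_const ?_ ?_) _
    · exact UpperHalfPlane.continuous_im.subtype_mk _
    · exact fun x ↦ NNReal.ne_iff.mp x.im_ne_zero
  have hmp : MeasurePreserving UpperHalfPlane.coe (volume.comap UpperHalfPlane.coe)
      (volume.restrict (.range UpperHalfPlane.coe)) :=
    ⟨UpperHalfPlane.measurable_coe, by rw [UpperHalfPlane.measurableEmbedding_coe.map_comap]⟩
  rw [UpperHalfPlane.volume_def, lintegral_withDensity_eq_lintegral_mul _ hmeas.coe_nnreal_ennreal hH,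
    show {z : ℂ | 0 < z.im} = Set.range UpperHalfPlane.coe from UpperHalfPlane.range_coe.symm,
    ← hmp.lintegral_comp_emb UpperHalfPlane.measurableEmbedding_coe]
  refine lintegral_congr fun z ↦ ?_
  simp only [Pi.mul_apply]
  congr 1
  rw [← ENNReal.ofReal_coe_nnreal]
  simp

theorem exp_sub_two_mul_sq_le {v : ℝ} (hv : -(1 / 2) ≤ v) : Real.exp (v - 2 * v ^ 2) ≤ 1 + v := by
  have h0 : 0 < 1 + v := by linarith
  rw [← Real.le_log_iff_exp_le h0]
  refine le_trans ?_ (Real.one_sub_inv_le_log_of_pos h0)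
  rw [← sub_nonneg]
  have : 1 - (1 + v)⁻¹ - (v - 2 * v ^ 2) = v ^ 2 * (1 + 2 * v) / (1 + v) := by
    field_simp; ring
  rw [this]
  exact div_nonneg (mul_nonneg (sq_nonneg _) (by linarith)) h0.le

/-- With `v = (y - y₀) / y₀`, the exponential of the linear term in `log (1 + v)` stands in for `(y
/ y₀)^(2k)`. The quadratic error is at most `4kv² ≤ 1` in the exponent, hence the single factor `e`.
-/
theorem pow_mul_exp_le {k : ℕ} {y y₀ : ℝ} (hy₀ : 0 < y₀) (hv : -(1 / 2) ≤ (y - y₀) / y₀)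
    (hk : 4 * k * ((y - y₀) / y₀) ^ 2 ≤ 1) :
    y₀ ^ (2 * k) * Real.exp (2 * k * ((y - y₀) / y₀)) ≤ Real.exp 1 * y ^ (2 * k) := by
  set v := (y - y₀) / y₀ with hvdef
  have hy : y = y₀ * (1 + v) := by rw [hvdef]; field_simp; ring
  have h1 : Real.exp (2 * k * v) = Real.exp (4 * k * v ^ 2) * Real.exp (v - 2 * v ^ 2) ^ (2 * k) := by
    rw [← Real.exp_nat_mul, ← Real.exp_add]; push_cast; ring_nf
  rw [h1, hy, mul_pow, mul_left_comm]
  gcongr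
  exact exp_sub_two_mul_sq_le hv

/-- A holomorphic function is controlled pointwise by its weighted `L²` norm on a unit hyperbolic
ball, with constant growing linearly in the weight. -/
theorem ofReal_normSqIm_le {k : ℕ} (hk : 1 ≤ k) {f : ℍ → ℂ} (hf : MDifferentiable 𝓘(ℂ) 𝓘(ℂ) f)
    (z₀ : ℍ) :
    ENNReal.ofReal (normSqIm k f z₀) ≤ ENNReal.ofReal (9 * Real.exp 1 / Real.pi * k) *
      ∫⁻ z in Metric.closedBall z₀ 1, ENNReal.ofReal (normSqIm k f z) := by
  set y₀ := z₀.im with hy₀def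
  have hy₀ : 0 < y₀ := z₀.im_pos
  have hk0 : (1 : ℝ) ≤ k := by exact_mod_cast hk
  have hsk : 1 ≤ √(k : ℝ) := by simpa using hk0
  -- Chosen so that `|v| ≤ r / y₀` gives exactly `4kv² ≤ 1`, while `r ≤ y₀ / 2`.
  set r := y₀ / (2 * √(k : ℝ)) with hr
  have hr0 : 0 < r := by positivity
  have hr2 : r ^ 2 = y₀ ^ 2 / (4 * k) := by
    rw [hr, div_pow, mul_pow, Real.sq_sqrt (by positivity)]; norm_num
  have hry : r ≤ y₀ / 2 := by
    rw [hr]; gcongr; linarith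
  have him : ∀ z ∈ Metric.ball (z₀ : ℂ) r, |z.im - y₀| < r := fun z hz ↦ by
    have := Complex.abs_im_le_norm (z - z₀)
    rw [mem_ball_iff_norm] at hz
    simpa using this.trans_lt hz
  have hball : Metric.ball (z₀ : ℂ) r ⊆ {z : ℂ | 0 < z.im} := fun z hz ↦ by
    have := (abs_lt.mp (him z hz)).1
    show 0 < z.im
    linarith
  -- The exponential factor has modulus `exp (k (y - y₀) / y₀)`, a holomorphic substitute for the
  -- weight `(y / y₀)^k`.
  let g : ℂ → ℂ := fun z ↦ f (UpperHalfPlane.ofComplex z) *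
    Complex.exp (-(Complex.I * (k / y₀ : ℝ) * (z - z₀)))
  have hg : DifferentiableOn ℂ g (Metric.ball (z₀ : ℂ) r) :=
    ((UpperHalfPlane.mdifferentiable_iff.mp hf).mono hball).mul (by fun_prop)
  have hmv := enorm_sq_mul_le_lintegral_ball hr0.le hg
  have hg0 : g z₀ = f z₀ := by simp [g]
  let H : ℂ → ENNReal := fun z ↦ (Metric.closedBall z₀ 1).indicator
    (fun z ↦ ENNReal.ofReal (normSqIm k f z)) (UpperHalfPlane.ofComplex z)
  have hHeq : (fun z : ℍ ↦ H z) = (Metric.closedBall z₀ 1).indicator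
      (fun z ↦ ENNReal.ofReal (normSqIm k f z)) := by
    ext z; simp [H]
  have hH : Measurable fun z : ℍ ↦ H z := by
    rw [hHeq]
    exact (continuous_normSqIm k hf.continuous).measurable.ennreal_ofReal.indicator
      Metric.isClosed_closedBall.measurableSet
  have hpt : ∀ z ∈ Metric.ball (z₀ : ℂ) r, ENNReal.ofReal (y₀ ^ (2 * k)) * ‖g z‖ₑ ^ 2 ≤
      ENNReal.ofReal (9 / 4 * Real.exp 1 * y₀ ^ 2) * (ENNReal.ofReal (1 / z.im ^ 2) * H z) := by
    intro z hz
    have hzpos : 0 < z.im := hball hz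
    lift z to ℍ using hzpos
    have hzim := abs_lt.mp (him z hz)
    simp only [UpperHalfPlane.coe_im] at hzim
    have hmem : z ∈ Metric.closedBall z₀ 1 := by
      refine (UpperHalfPlane.dist_le_dist_coe_div_sqrt z z₀).trans ?_
      rw [div_le_one (by positivity)]
      refine (Metric.mem_ball.mp hz).le.trans (Real.le_sqrt_of_sq_le ?_)
      have : y₀ / 2 ≤ z.im := by linarith
      nlinarith
    have hHz : H z = ENNReal.ofReal (normSqIm k f z) := by
      rw [congrFun hHeq z, Set.indicator_of_mem hmem]
    have hnorm : ‖g z‖ = ‖f z‖ * Real.exp (k * ((z.im - y₀) / y₀)) := by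
      simp only [g, norm_mul, UpperHalfPlane.ofComplex_apply, Complex.norm_exp]
      congr 2
      simp
      ring
    rw [hHz, ← ofReal_norm, ← ENNReal.ofReal_pow (norm_nonneg _), ← ENNReal.ofReal_mul (by positivity),
      ← ENNReal.ofReal_mul (by positivity), ← ENNReal.ofReal_mul (by positivity)]
    refine ENNReal.ofReal_le_ofReal ?_
    have hv1 : -(1 / 2) ≤ (z.im - y₀) / y₀ := by
      rw [le_div_iff₀ hy₀]; linarith
    have hv2 : 4 * k * ((z.im - y₀) / y₀) ^ 2 ≤ 1 := by
      have : (z.im - y₀) ^ 2 ≤ r ^ 2 := by nlinarith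
      rw [hr2] at this
      rw [div_pow, mul_div_assoc', div_le_one (by positivity)]
      rw [le_div_iff₀ (by positivity)] at this
      linarith
    have hmain := pow_mul_exp_le hy₀ hv1 hv2
    -- `y ≤ 3y₀/2` on the disc; this is the source of `9 / 4` when passing from Euclidean to
    -- hyperbolic area.
    have hy : 1 ≤ 9 / 4 * y₀ ^ 2 * (1 / z.im ^ 2) := by
      rw [mul_one_div, le_div_iff₀ (by positivity)]
      nlinarith
    rw [hnorm, mul_pow, ← Real.exp_nat_mul, normSqIm, UpperHalfPlane.coe_im]
    calc y₀ ^ (2 * k) * (‖f z‖ ^ 2 * Real.exp ((2 : ℕ) * (k * ((z.im - y₀) / y₀))))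
        = ‖f z‖ ^ 2 * (y₀ ^ (2 * k) * Real.exp (2 * k * ((z.im - y₀) / y₀))) := by
          push_cast; ring_nf
      _ ≤ ‖f z‖ ^ 2 * (Real.exp 1 * z.im ^ (2 * k)) := by gcongr
      _ ≤ ‖f z‖ ^ 2 * (Real.exp 1 * z.im ^ (2 * k)) * (9 / 4 * y₀ ^ 2 * (1 / z.im ^ 2)) :=
          le_mul_of_one_le_right (by positivity) hy
      _ = _ := by ring
  have hint : ENNReal.ofReal (normSqIm k f z₀) * ENNReal.ofReal (Real.pi * r ^ 2) ≤
      ENNReal.ofReal (9 / 4 * Real.exp 1 * y₀ ^ 2) *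
        ∫⁻ z in Metric.closedBall z₀ 1, ENNReal.ofReal (normSqIm k f z) := by
    calc ENNReal.ofReal (normSqIm k f z₀) * ENNReal.ofReal (Real.pi * r ^ 2)
        = ENNReal.ofReal (y₀ ^ (2 * k)) * (‖g z₀‖ₑ ^ 2 * ENNReal.ofReal (Real.pi * r ^ 2)) := by
          rw [hg0, normSqIm, ENNReal.ofReal_mul (by positivity),
            ENNReal.ofReal_pow (norm_nonneg _), ofReal_norm]
          ring
      _ ≤ ENNReal.ofReal (y₀ ^ (2 * k)) * ∫⁻ z in Metric.ball (z₀ : ℂ) r, ‖g z‖ₑ ^ 2 := by gcongr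
      _ = ∫⁻ z in Metric.ball (z₀ : ℂ) r, ENNReal.ofReal (y₀ ^ (2 * k)) * ‖g z‖ₑ ^ 2 :=
          (lintegral_const_mul' _ _ ENNReal.ofReal_ne_top).symm
      _ ≤ ∫⁻ z in Metric.ball (z₀ : ℂ) r, ENNReal.ofReal (9 / 4 * Real.exp 1 * y₀ ^ 2) *
            (ENNReal.ofReal (1 / z.im ^ 2) * H z) :=
          setLIntegral_mono' Metric.isOpen_ball.measurableSet hpt
      _ ≤ ∫⁻ z in {z : ℂ | 0 < z.im}, ENNReal.ofReal (9 / 4 * Real.exp 1 * y₀ ^ 2) *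
            (ENNReal.ofReal (1 / z.im ^ 2) * H z) := lintegral_mono_set hball
      _ = ENNReal.ofReal (9 / 4 * Real.exp 1 * y₀ ^ 2) * ∫⁻ z : ℍ, H z := by
          rw [lintegral_const_mul' _ _ ENNReal.ofReal_ne_top, lintegral_coe_upperHalfPlane hH]
      _ = _ := by
          rw [hHeq, lintegral_indicator Metric.isClosed_closedBall.measurableSet]
  have hcancel : ENNReal.ofReal (Real.pi * r ^ 2) * ENNReal.ofReal (4 * k / (Real.pi * y₀ ^ 2)) = 1 := by
    rw [← ENNReal.ofReal_mul (by positivity), hr2, ← ENNReal.ofReal_one]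
    congr 1
    field_simp
  calc ENNReal.ofReal (normSqIm k f z₀)
      = ENNReal.ofReal (normSqIm k f z₀) * ENNReal.ofReal (Real.pi * r ^ 2) *
          ENNReal.ofReal (4 * k / (Real.pi * y₀ ^ 2)) := by rw [mul_assoc, hcancel, mul_one]
    _ ≤ ENNReal.ofReal (9 / 4 * Real.exp 1 * y₀ ^ 2) *
        (∫⁻ z in Metric.closedBall z₀ 1, ENNReal.ofReal (normSqIm k f z)) *
          ENNReal.ofReal (4 * k / (Real.pi * y₀ ^ 2)) := by gcongr
    _ = _ := by
      rw [mul_right_comm, ← ENNReal.ofReal_mul (by positivity)]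
      congr 2
      field_simp

/-! ### Passage to the quotient and the Petersson norm -/

theorem normSqIm_smul {Γ : Subgroup PSL(2, ℝ)} {k : ℕ} (f : CuspForms Γ k) (γ : Γ) (z : ℍ) :
    normSqIm k f (γ • z) = normSqIm k f z := by
  obtain ⟨γ, hγ⟩ := γ
  obtain ⟨g, rfl⟩ := QuotientGroup.mk_surjective γ
  have hg : Matrix.SpecialLinearGroup.toGL g ∈ matrixLift Γ := ⟨g, hγ, rfl⟩
  have h := SlashInvariantFormClass.norm_petersson_smul (f := f) (f' := f) (τ := z) hg
  have key : ∀ τ : ℍ, ‖UpperHalfPlane.petersson (2 * (k : ℤ)) f f τ‖ = normSqIm k f τ := by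
    intro τ
    have : (τ.im : ℂ) ^ (2 * (k : ℤ)) = ((τ.im ^ (2 * k) : ℝ) : ℂ) := by
      push_cast; exact_mod_cast rfl
    rw [UpperHalfPlane.petersson, this, norm_mul, norm_mul, RCLike.norm_conj, normSqIm,
      Complex.norm_of_nonneg (pow_nonneg τ.im_pos.le _), sq]
  rw [key, key] at h
  exact h

theorem continuous_cuspForm {Γ : Subgroup PSL(2, ℝ)} {k : ℕ} (f : CuspForms Γ k) : Continuous f :=
  (CuspFormClass.holo f).continuous

theorem normSqIm_bddAbove {Γ : Subgroup PSL(2, ℝ)} (hc : IsCocompact Γ) {k : ℕ}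
    (f : CuspForms Γ k) : ∃ B, ∀ z, normSqIm k f z ≤ B := by
  obtain ⟨R, hR⟩ := exists_isCompact_cover hc
  obtain ⟨B, hB⟩ := (isCompact_closedBall UpperHalfPlane.I R).bddAbove_image
    (continuous_normSqIm k (continuous_cuspForm f)).continuousOn
  refine ⟨B, fun z ↦ ?_⟩
  obtain ⟨γ, hγ⟩ := hR z
  rw [← normSqIm_smul f γ]
  exact hB ⟨_, hγ, rfl⟩

section FundamentalDomain

variable {Γ : Subgroup PSL(2, ℝ)} {D : Set ℍ}

/-- Unfolding: the integral over the ball is a sum over `γ` of integrals over `D`, and by invariance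
of `h` each point of `D` is counted once for every `γ` sending it into the ball. -/
theorem lintegral_ball_le (hΓ : IsFuchsian Γ) (hD : IsFundamentalDomain Γ D volume)
    {w : ℍ} {r : ℝ} {N : ℕ} (hN : ∀ z : ℍ, {γ : Γ | dist (γ • z) w ≤ r}.encard ≤ N)
    {h : ℍ → ENNReal} (hh : Measurable h) (hinv : ∀ (γ : Γ) z, h (γ • z) = h z) :
    ∫⁻ z in Metric.closedBall w r, h z ≤ N * ∫⁻ z in D, h z := by
  have := countable_of_isFuchsian hΓ
  have hB : MeasurableSet (Metric.closedBall w r) := Metric.isClosed_closedBall.measurableSet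
  rw [← lintegral_indicator hB, hD.lintegral_eq_tsum'', ← lintegral_tsum (f := fun (γ : Γ) z ↦
      (Metric.closedBall w r).indicator h (γ • z)) fun γ ↦
    ((hh.indicator hB).comp (measurable_const_smul γ)).aemeasurable,
    ← lintegral_const_mul _ hh]
  refine lintegral_mono fun z ↦ ?_
  calc ∑' γ : Γ, (Metric.closedBall w r).indicator h (γ • z)
      = ∑' γ : Γ, {γ : Γ | dist (γ • z) w ≤ r}.indicator (fun _ ↦ h z) γ := by
        refine tsum_congr fun γ ↦ ?_
        by_cases hγ : dist (γ • z) w ≤ r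
        · rw [Set.indicator_of_mem (by exact hγ), Set.indicator_of_mem (by exact hγ), hinv]
        · rw [Set.indicator_of_notMem (by exact hγ), Set.indicator_of_notMem (by exact hγ)]
    _ = {γ : Γ | dist (γ • z) w ≤ r}.encard * h z := by
        rw [← tsum_subtype, ENNReal.tsum_set_const]
    _ ≤ N * h z := by
        gcongr
        exact_mod_cast hN z

/-- Unfolding in the opposite direction: every orbit meets the compact ball `B`, so each point of
`D` is counted at least once in `volume B`. -/
theorem volume_lt_top (hΓ : IsFuchsian Γ) (hc : IsCocompact Γ)
    (hD : IsFundamentalDomain Γ D volume) : volume D < ⊤ := by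
  have := countable_of_isFuchsian hΓ
  obtain ⟨R, hR⟩ := exists_isCompact_cover hc
  set B := Metric.closedBall UpperHalfPlane.I R
  have hB : MeasurableSet B := Metric.isClosed_closedBall.measurableSet
  refine lt_of_le_of_lt ?_
    ((isCompact_closedBall UpperHalfPlane.I R).measure_lt_top (μ := (volume : Measure ℍ)))
  change volume D ≤ volume B
  have hm : Measurable (B.indicator (1 : ℍ → ENNReal)) := measurable_one.indicator hB
  rw [← lintegral_indicator_one hB, hD.lintegral_eq_tsum'', ← lintegral_tsum (f := fun (γ : Γ) z ↦ B.indicator (1 : ℍ → ENNReal) (γ • z))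
    fun γ ↦ (hm.comp (measurable_const_smul γ)).aemeasurable, ← setLIntegral_one]
  refine lintegral_mono fun z ↦ ?_
  obtain ⟨γ, hγ⟩ := hR z
  refine le_trans ?_ (ENNReal.le_tsum γ)
  rw [Set.indicator_of_mem hγ]
  rfl

theorem integrableOn_petersson (hΓ : IsFuchsian Γ) (hc : IsCocompact Γ)
    (hD : IsFundamentalDomain Γ D volume) {k : ℕ} (f₁ f₂ : CuspForms Γ k) :
    IntegrableOn (fun z ↦ f₁ z * (starRingEnd ℂ) (f₂ z) * ((z.im : ℝ) : ℂ) ^ (2 * k)) D := by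
  obtain ⟨B₁, h₁⟩ := normSqIm_bddAbove hc f₁
  obtain ⟨B₂, h₂⟩ := normSqIm_bddAbove hc f₂
  have hcont : Continuous fun z : ℍ ↦
      f₁ z * (starRingEnd ℂ) (f₂ z) * ((z.im : ℝ) : ℂ) ^ (2 * k) := by
    have := continuous_cuspForm f₁
    have := continuous_cuspForm f₂
    fun_prop
  refine Measure.integrableOn_of_bounded (M := B₁ + B₂) (volume_lt_top hΓ hc hD).ne
    hcont.aestronglyMeasurable (.of_forall fun z ↦ ?_)
  refine le_trans ?_ (add_le_add (h₁ z) (h₂ z))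
  have hy : 0 ≤ z.im ^ (2 * k) := pow_nonneg z.im_pos.le _
  rw [norm_mul, norm_mul, RCLike.norm_conj, norm_pow, Complex.norm_of_nonneg z.im_pos.le, normSqIm,
    normSqIm, ← add_mul]
  gcongr
  nlinarith [sq_nonneg (‖f₁ z‖ - ‖f₂ z‖), sq_nonneg ‖f₁ z‖, sq_nonneg ‖f₂ z‖]

theorem petersson_self_integrand {k : ℕ} (f : CuspForms Γ k) (z : ℍ) :
    f z * (starRingEnd ℂ) (f z) * ((z.im : ℝ) : ℂ) ^ (2 * k) = (normSqIm k f z : ℂ) := by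
  rw [Complex.mul_conj, Complex.normSq_eq_norm_sq, normSqIm]
  push_cast
  rfl

theorem peterssonInner_self {k : ℕ} (f : CuspForms Γ k) :
    peterssonInner D f f = ((∫ z in D, normSqIm k f z : ℝ) : ℂ) := by
  rw [peterssonInner, ← integral_complex_ofReal]
  simp_rw [petersson_self_integrand]

theorem integrableOn_normSqIm (hΓ : IsFuchsian Γ) (hc : IsCocompact Γ)
    (hD : IsFundamentalDomain Γ D volume) {k : ℕ} (f : CuspForms Γ k) :
    IntegrableOn (normSqIm k f) D := by
  have := (integrableOn_petersson hΓ hc hD f f).re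
  simp only [petersson_self_integrand] at this
  exact this

/-- Evaluation at a point of `ℍ` is bounded by the Petersson norm, uniformly in the point and with
a constant growing linearly in the weight. -/
theorem exists_normSqIm_le (hΓ : IsFuchsian Γ) (hc : IsCocompact Γ) :
    ∃ C : ℝ, 0 ≤ C ∧ ∀ k : ℕ, 1 ≤ k → ∀ D : Set ℍ, IsFundamentalDomain Γ D volume →
      ∀ (f : CuspForms Γ k) (z : ℍ), normSqIm k f z ≤ C * k * ∫ z in D, normSqIm k f z := by
  obtain ⟨N, hN⟩ := exists_card_smul_mem_ball_le hΓ hc 1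
  refine ⟨9 * Real.exp 1 / Real.pi * N, by positivity, fun k hk D hD f z ↦ ?_⟩
  have h0 : 0 ≤ ∫ z in D, normSqIm k f z := integral_nonneg fun z ↦ normSqIm_nonneg k f z
  rw [← ENNReal.ofReal_le_ofReal_iff (by positivity)]
  have hcont := continuous_normSqIm k (continuous_cuspForm f)
  calc ENNReal.ofReal (normSqIm k f z)
      ≤ ENNReal.ofReal (9 * Real.exp 1 / Real.pi * k) *
        ∫⁻ z in Metric.closedBall z 1, ENNReal.ofReal (normSqIm k f z) :=
        ofReal_normSqIm_le hk (CuspFormClass.holo f) z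
    _ ≤ ENNReal.ofReal (9 * Real.exp 1 / Real.pi * k) *
        (N * ∫⁻ z in D, ENNReal.ofReal (normSqIm k f z)) := by
        gcongr
        exact lintegral_ball_le hΓ hD (fun w ↦ hN w z) hcont.measurable.ennreal_ofReal
          fun γ w ↦ by rw [normSqIm_smul]
    _ = _ := by
        rw [← ofReal_integral_eq_lintegral_ofReal (integrableOn_normSqIm hΓ hc hD f)
          (.of_forall fun z ↦ normSqIm_nonneg k f z), ← ENNReal.ofReal_natCast,
          ← ENNReal.ofReal_mul (by positivity), ← ENNReal.ofReal_mul (by positivity)]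
        congr 1
        ring

/-- The Petersson inner product makes the space of cusp forms an inner product space. -/
@[reducible]
noncomputable def peterssonCore (hΓ : IsFuchsian Γ) (hc : IsCocompact Γ)
    (hD : IsFundamentalDomain Γ D volume) {k : ℕ} (hk : 1 ≤ k) :
    InnerProductSpace.Core ℂ (CuspForms Γ k) where
  -- The arguments are swapped because `inner` is conjugate-linear in its first slot and the
  -- Petersson product in its second.
  inner f g := peterssonInner D g f
  conj_inner_symm f g := by
    simp only [peterssonInner]
    rw [← integral_conj]
    congr 1
    ext z
    simp only [map_mul, map_pow, Complex.conj_conj, Complex.conj_ofReal]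
    ring
  re_inner_nonneg f := by
    rw [peterssonInner_self]
    exact integral_nonneg fun z ↦ normSqIm_nonneg k f z
  add_left f g h := by
    simp only [peterssonInner]
    rw [← integral_add (integrableOn_petersson hΓ hc hD h f)
      (integrableOn_petersson hΓ hc hD h g)]
    congr 1
    ext z
    simp
    ring
  smul_left f g c := by
    simp only [peterssonInner]
    rw [← integral_const_mul]
    congr 1
    ext z
    simp
    ring
  -- The pointwise bound forces a form of norm zero to vanish everywhere.
  definite f hf := by
    rw [peterssonInner_self] at hf
    obtain ⟨C, _, hC⟩ := exists_normSqIm_le hΓ hc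
    ext z
    have h := hC k hk D hD f z
    rw [Complex.ofReal_eq_zero.mp hf, mul_zero] at h
    have hy : 0 < z.im ^ (2 * k) := pow_pos z.im_pos _
    have h1 : ‖f z‖ ^ 2 ≤ 0 := nonpos_of_mul_nonpos_left h hy
    simpa using h1

end FundamentalDomain

/-! ### Existence of a fundamental domain -/

/-- An element of `PSL(2, ℝ)` other than `1` fixes at most one point of `ℍ`. -/
theorem subsingleton_fixedBy {γ : PSL(2, ℝ)} (hγ : γ ≠ 1) :
    (MulAction.fixedBy ℍ γ).Subsingleton := by
  obtain ⟨g, rfl⟩ := QuotientGroup.mk_surjective γ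
  have hg : g ∉ Subgroup.center SL(2, ℝ) := fun h ↦ hγ ((QuotientGroup.eq_one_iff g).mpr h)
  intro z hz w hw
  set G : GL (Fin 2) ℝ := Matrix.SpecialLinearGroup.mapGL ℝ g
  have hpos : 0 < G.det.val := by simp [G]
  have hz' : G • z = z := hz
  have hw' : G • w = w := hw
  have hG : G ∉ Subgroup.center (GL (Fin 2) ℝ) := by
    intro h
    refine hg (Subgroup.mem_center_iff.mpr fun h' ↦ ?_)
    have := Subgroup.mem_center_iff.mp h (Matrix.SpecialLinearGroup.mapGL ℝ h')
    rw [← map_mul, ← map_mul] at this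
    exact Matrix.SpecialLinearGroup.mapGL_injective this
  have hell := UpperHalfPlane.isElliptic_of_exists_smul_eq_self hpos hG ⟨z, hz'⟩
  rw [(UpperHalfPlane.gl_smul_eq_self_iff_eq_fixedPt hpos hell).mp hz',
    (UpperHalfPlane.gl_smul_eq_self_iff_eq_fixedPt hpos hell).mp hw']

instance : NullSingletonClass (volume : Measure ℍ) where
  measure_singleton z := by
    rw [UpperHalfPlane.volume_eq_lintegral, Set.image_singleton]
    simp

/-- A cocompact Fuchsian group has a measurable fundamental domain. -/
theorem exists_isFundamentalDomain {Γ : Subgroup PSL(2, ℝ)} (hΓ : IsFuchsian Γ)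
    (hc : IsCocompact Γ) : ∃ D : Set ℍ, IsFundamentalDomain Γ D volume := by
  have := countable_of_isFuchsian hΓ
  obtain ⟨R, hR⟩ := exists_isCompact_cover hc
  set K := Metric.closedBall UpperHalfPlane.I R
  have hK : IsCompact K := isCompact_closedBall _ _
  obtain ⟨φ, hφ⟩ := exists_measurableEmbedding_real ℍ
  -- From each orbit, keep the points of `K` minimizing the injective Borel function `φ`. Only
  -- finitely many `γ` carry a given point into `K`, so a minimum exists, and injectivity makes the
  -- minimizing point unique.
  refine ⟨K ∩ ⋂ γ : Γ, ((γ • ·) ⁻¹' K)ᶜ ∪ {z | φ z ≤ φ (γ • z)}, ?_⟩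
  refine IsFundamentalDomain.mk'' ?_ ?_ ?_ fun γ ↦ (measurePreserving_smul γ volume).quasiMeasurePreserving
  · refine MeasurableSet.nullMeasurableSet ?_
    refine hK.measurableSet.inter (MeasurableSet.iInter fun γ ↦ ?_)
    exact (measurable_const_smul γ hK.measurableSet).compl.union
      (measurableSet_le hφ.measurable (hφ.measurable.comp (measurable_const_smul γ)))
  · refine .of_forall fun z ↦ ?_
    obtain ⟨γ₀, h₀⟩ := hR z
    have hfin : {γ : Γ | γ • z ∈ K}.Finite := by
      refine ((finite_smul_inter hΓ hK).preimage (f := fun γ : Γ ↦ γ * γ₀⁻¹)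
        (mul_left_injective _).injOn).subset fun γ hγ ↦ ⟨γ₀ • z, h₀, ?_⟩
      simpa [mul_smul] using hγ
    obtain ⟨γ₁, h₁, hmin⟩ := Set.exists_min_image _ (fun γ : Γ ↦ φ (γ • z)) hfin ⟨γ₀, h₀⟩
    refine ⟨γ₁, h₁, Set.mem_iInter.mpr fun γ ↦ ?_⟩
    by_cases hγ : γ • γ₁ • z ∈ K
    · right
      have := hmin (γ * γ₁) (by simpa [mul_smul] using hγ)
      simpa [mul_smul] using this
    · exact .inl hγ
  · intro γ hγ
    have hγ' : (γ : PSL(2, ℝ)) ≠ 1 := by simpa using hγ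
    rw [AEDisjoint]
    -- By uniqueness of the minimizer, a point in both `D` and its translate is fixed by `γ`, so the
    -- overlap has at most one point.
    refine measure_mono_null (t := MulAction.fixedBy ℍ (γ : PSL(2, ℝ))) ?_
      ((subsingleton_fixedBy hγ').measure_zero _)
    rintro _ ⟨⟨z, ⟨hzK, hz⟩, rfl⟩, hγzK, hγz⟩
    have h1 := ((Set.mem_iInter.mp hz γ).resolve_left fun h ↦ h hγzK : φ z ≤ φ (γ • z))
    have h2 := (Set.mem_iInter.mp hγz γ⁻¹).resolve_left fun h ↦ h (by
      simpa using hzK)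
    have h3 : φ (γ • z) ≤ φ z := by simpa using h2
    have h4 : γ • z = z := hφ.injective (h3.antisymm h1)
    change γ • γ • z = γ • z
    rw [h4, h4]

/-! ### Bessel's inequality, finite dimension and orthonormal bases -/

section InnerProductSpace

variable {V : Type*} [NormedAddCommGroup V] [InnerProductSpace ℂ V]

/-- Bessel's inequality for a bounded linear functional and a finite orthonormal family. -/
theorem sum_norm_sq_le_of_orthonormal (ev : V →ₗ[ℂ] ℂ) {A : ℝ} (hA : 0 ≤ A)
    (h : ∀ v, ‖ev v‖ ^ 2 ≤ A * ‖v‖ ^ 2) {ι : Type*} [Fintype ι] {f : ι → V}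
    (hf : Orthonormal ℂ f) : ∑ j, ‖ev (f j)‖ ^ 2 ≤ A := by
  set s := ∑ j, ‖ev (f j)‖ ^ 2 with hs
  -- `v` represents `ev` on the span of the family, so `ev v = ‖v‖² = s`, and the hypothesis at `v`
  -- reads `s² ≤ A s`.
  set v := ∑ j, (starRingEnd ℂ) (ev (f j)) • f j with hv
  have h1 : ev v = (s : ℂ) := by
    rw [hv, map_sum, hs, Complex.ofReal_sum]
    refine Finset.sum_congr rfl fun j _ ↦ ?_
    rw [map_smul, smul_eq_mul, Complex.conj_mul']
    push_cast; rfl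
  have h2 : ‖v‖ ^ 2 = s := by
    have : inner ℂ v v = (s : ℂ) := by
      rw [hv, hf.inner_sum, hs, Complex.ofReal_sum]
      refine Finset.sum_congr rfl fun j _ ↦ ?_
      rw [Complex.conj_conj, Complex.mul_conj']
      push_cast; rfl
    have h' := inner_self_eq_norm_sq_to_K (𝕜 := ℂ) v
    rw [this] at h'
    exact Complex.ofReal_injective (by simpa using h'.symm)
  have h3 := h v
  have h0 : 0 ≤ s := Finset.sum_nonneg fun _ _ ↦ sq_nonneg _
  rw [h1, h2, Complex.norm_of_nonneg h0] at h3
  by_contra! hlt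
  nlinarith

theorem finiteDimensional_of_orthonormal_card_le {N : ℕ}
    (h : ∀ (d : ℕ) (f : Fin d → V), Orthonormal ℂ f → d ≤ N) : FiniteDimensional ℂ V := by
  by_contra hinf
  have hr : ((N + 1 : ℕ) : Cardinal) ≤ Module.rank ℂ V := by
    have : Cardinal.aleph0 ≤ Module.rank ℂ V := by
      rw [← not_lt, Module.rank_lt_aleph0_iff]; exact hinf
    exact (Cardinal.natCast_lt_aleph0.le).trans this
  obtain ⟨v, hv⟩ := exists_linearIndependent_of_le_rank hr
  have := h _ _ (InnerProductSpace.gramSchmidtNormed_orthonormal (𝕜 := ℂ) hv)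
  omega

end InnerProductSpace

variable {Γ : Subgroup PSL(2, ℝ)} {D : Set ℍ}

theorem supSum_le {k : ℕ} (hk : 1 ≤ k) (hΓ : IsFuchsian Γ) (hc : IsCocompact Γ)
    (hD : IsFundamentalDomain Γ D volume) {C : ℝ} (hC0 : 0 ≤ C)
    (hC : ∀ (f : CuspForms Γ k) (z : ℍ), normSqIm k f z ≤ C * ∫ z in D, normSqIm k f z)
    {d : ℕ} {f : Fin d → CuspForms Γ k}
    (hf : ∀ i j, peterssonInner D (f i) (f j) = if i = j then 1 else 0) (z : ℍ) :
    supSum f z ≤ C := by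
  let core := peterssonCore hΓ hc hD hk
  let : NormedAddCommGroup (CuspForms Γ k) := core.toNormedAddCommGroup
  let : InnerProductSpace ℂ (CuspForms Γ k) := .ofCore core.toCore
  have hf' : Orthonormal ℂ f := by
    rw [orthonormal_iff_ite]
    intro i j
    exact (hf j i).trans (by simp only [eq_comm])
  have hy : 0 < z.im ^ (2 * k) := pow_pos z.im_pos _
  let ev : CuspForms Γ k →ₗ[ℂ] ℂ :=
    { toFun := fun f ↦ f z, map_add' := fun _ _ ↦ rfl, map_smul' := fun _ _ ↦ rfl }
  have hnorm (v : CuspForms Γ k) : ‖v‖ ^ 2 = ∫ z in D, normSqIm k v z := by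
    have h' := inner_self_eq_norm_sq_to_K (𝕜 := ℂ) v
    have h'' : inner ℂ v v = ((∫ z in D, normSqIm k v z : ℝ) : ℂ) := peterssonInner_self v
    rw [h''] at h'
    exact Complex.ofReal_injective (by simpa using h'.symm)
  have := sum_norm_sq_le_of_orthonormal ev (A := C / z.im ^ (2 * k)) (by positivity) (fun v ↦ by
    rw [hnorm, div_mul_eq_mul_div, le_div_iff₀ hy]
    exact hC v z) hf'
  rw [le_div_iff₀ hy, Finset.sum_mul] at this
  exact this

/-- For an orthonormal family of size `d`, `supSum` integrates to `d` over `D` and is at most `C`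
pointwise, so `d ≤ C * volume D`. Orthonormal families thus have bounded size, which forces finite
dimension. -/
theorem exists_isPeterssonONB {k : ℕ} (hk : 1 ≤ k) (hΓ : IsFuchsian Γ) (hc : IsCocompact Γ)
    (hD : IsFundamentalDomain Γ D volume) {C : ℝ} (hC0 : 0 ≤ C)
    (hC : ∀ (f : CuspForms Γ k) (z : ℍ), normSqIm k f z ≤ C * ∫ z in D, normSqIm k f z) :
    ∃ (d : ℕ) (f : Fin d → CuspForms Γ k), IsPeterssonONB D f := by
  let core := peterssonCore hΓ hc hD hk
  let : NormedAddCommGroup (CuspForms Γ k) := core.toNormedAddCommGroup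
  let : InnerProductSpace ℂ (CuspForms Γ k) := .ofCore core.toCore
  have horth {d : ℕ} {f : Fin d → CuspForms Γ k} (hf : Orthonormal ℂ f) (i j : Fin d) :
      peterssonInner D (f i) (f j) = if i = j then 1 else 0 :=
    (orthonormal_iff_ite.mp hf j i).trans (by simp only [eq_comm])
  have hvol : IsFiniteMeasure (volume.restrict D) :=
    ⟨by simpa using volume_lt_top hΓ hc hD⟩
  obtain ⟨N, hN⟩ := exists_nat_ge (C * volume.real D)
  have : FiniteDimensional ℂ (CuspForms Γ k) := by
    refine finiteDimensional_of_orthonormal_card_le (N := N) fun d f hf ↦ ?_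
    have h1 : ∫ z in D, supSum f z = d := by
      change ∫ z in D, ∑ j, normSqIm k (f j) z = d
      rw [integral_finsetSum _ fun j _ ↦ integrableOn_normSqIm hΓ hc hD (f j)]
      have h (j : Fin d) : ∫ z in D, normSqIm k (f j) z = 1 := by
        have := horth hf j j
        rw [peterssonInner_self, if_pos rfl] at this
        exact_mod_cast this
      simp [h]
    have h2 : ∫ z in D, supSum f z ≤ ∫ _ in D, C := by
      refine integral_mono ?_ (integrable_const _)
        fun z ↦ supSum_le hk hΓ hc hD hC0 hC (horth hf) z
      exact integrable_finsetSum _ fun j _ ↦ integrableOn_normSqIm hΓ hc hD (f j)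
    rw [h1, setIntegral_const, smul_eq_mul, mul_comm] at h2
    exact_mod_cast h2.trans hN
  let b := stdOrthonormalBasis ℂ (CuspForms Γ k)
  refine ⟨_, b, horth b.orthonormal, ?_⟩
  simpa using b.toBasis.span_eq

end Fuchsian

theorem corollary4p3 (Γ : Subgroup PSL(2, ℝ)) (hΓ : Fuchsian.IsFuchsian Γ)
    (hcpt : Fuchsian.IsCocompact Γ) :
    (∃ D : Set ℍ, IsFundamentalDomain Γ D volume) ∧
    ∃ C : ℝ, ∀ k : ℕ, 1 ≤ k → ∀ D : Set ℍ, IsFundamentalDomain Γ D volume →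
      (∃ (d : ℕ) (f : Fin d → Fuchsian.CuspForms Γ k), Fuchsian.IsPeterssonONB D f) ∧
      ∀ (d : ℕ) (f : Fin d → Fuchsian.CuspForms Γ k), Fuchsian.IsPeterssonONB D f →
        BddAbove (Set.range (Fuchsian.supSum f)) ∧
          (⨆ z : ℍ, Fuchsian.supSum f z) ≤ C * k := by
  refine ⟨Fuchsian.exists_isFundamentalDomain hΓ hcpt, ?_⟩
  obtain ⟨C, hC0, hC⟩ := Fuchsian.exists_normSqIm_le hΓ hcpt
  refine ⟨C, fun k hk D hD ↦ ?_⟩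
  have hCk : 0 ≤ C * k := by positivity
  refine ⟨Fuchsian.exists_isPeterssonONB hk hΓ hcpt hD hCk (hC k hk D hD), fun d f hf ↦ ?_⟩
  have hle : ∀ z, Fuchsian.supSum f z ≤ C * k :=
    Fuchsian.supSum_le hk hΓ hcpt hD hCk (hC k hk D hD) hf.orthonormal
  exact ⟨⟨C * k, Set.forall_mem_range.mpr hle⟩, ciSup_le hle⟩
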